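/- All graphs are simple, and a graph $G$ is regarded as a metric space (metric graph) by identifying every edge with a copy of $[0,1]$ and taking the shortest-path distance $d$, with $d=\infty$ between points of different connected components. A geodesic triangle $T$ consists of three (not necessarily distinct) points of $G$ and three geodesics joining them in pairs; $\delta(T)$ is the infimum of the $\delta\ge 0$ such that each side of $T$ lies in the $\delta$-neighbourhood of the union of the other two sides, and $\delta(G)\in[0,\infty]$ is the supremum of $\delta(T)$ over all geodesic triangles $T$ in $G$ (for a disconnected graph this is the supremum of the constants of its connected components). The direct product $G_1\times G_2$ has vertex set $V(G_1)\times V(G_2)$, and $(u_1,v_1)$ and $(u_2,v_2)$ are adjacent if and only if $u_1u_2\in E(G_1)$ and $v_1v_2\in E(G_2)$. Let $P_k$ denote the path graph with $k$ vertices. **Theorem.** Let $m\ge n\ge 2$. If $n=2$, then $\delta(P_m\times P_2)=0$. If $n\ge 3$, then $$\min\Big\{\frac m2,\,n-1\Big\}-1\;\le\;\delta(P_m\times P_n)\;\le\;\min\Big\{\frac m2,\,n\Big\}-\frac12 .$$ Furthermore, if $m\le 2n-3$ and $m$ is odd, then $\delta(P_m\times P_n)=(m-1)/2$. -/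

import Mathlib

open scoped ENNReal NNReal

namespace GraphHyperbolicity

/-- The direct (tensor) product of two simple graphs. -/
def directProduct {V W : Type*} (G : SimpleGraph V) (H : SimpleGraph W) :
    SimpleGraph (V × W) where
  Adj p q := G.Adj p.1 q.1 ∧ H.Adj p.2 q.2
  symm := ⟨fun _ _ h => ⟨h.1.symm, h.2.symm⟩⟩
  loopless := ⟨fun _ h => G.irrefl h.1⟩

section Realization

variable {V : Type*} (G : SimpleGraph V)

/-- `x` lies on the closed cell spanned by `a` and `b`: the vertex `a` if `a = b`, and the closed
edge `[a, b]` if `a` and `b` are adjacent.  Points are given by barycentric coordinates. -/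
def OnCell (a b : V) (x : V →₀ ℝ) : Prop :=
  (a = b ∨ G.Adj a b) ∧ x ∈ segment ℝ (Finsupp.single a (1 : ℝ)) (Finsupp.single b (1 : ℝ))

/-- The graph `G` as a space: its points are the vertices of `G` and the points of its edges, every
edge being a copy of the unit interval. -/
def MetricGraph : Type _ := {x : V →₀ ℝ // ∃ a b, OnCell G a b x}

variable {G}

/-- The lengths of the candidates for a shortest path between the points `x` and `y` of the graph:
* if `x` and `y` lie on a common edge `[a, b]`, one can go along this edge, which is isometric to
  `[0, 1]` by means of the coordinate at `a`;
* if `a` is an end of the edge that contains `x` and `b` an end of the edge that contains `y`,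
  one can go from `x` straight to `a`, then along a shortest walk of `G` from `a` to `b`
  (of length `⊤` if there is none), and then straight from `b` to `y`. -/
inductive IsPathLength (x y : MetricGraph G) : ℝ≥0∞ → Prop
  | alongEdge (a b : V) (hx : OnCell G a b x.1) (hy : OnCell G a b y.1) :
      IsPathLength x y (ENNReal.ofReal |x.1 a - y.1 a|)
  | throughVertices (a b : V) (ha : x.1 a ≠ 0) (hb : y.1 b ≠ 0) :
      IsPathLength x y
        (ENNReal.ofReal (1 - x.1 a) + (G.edist a b : ℝ≥0∞) + ENNReal.ofReal (1 - y.1 b))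

theorem OnCell.exists_eq {a b : V} {x : V →₀ ℝ} (h : OnCell G a b x) :
    ∃ t : ℝ, 0 ≤ t ∧ t ≤ 1 ∧ x = Finsupp.single a (1 - t) + Finsupp.single b t := by
  obtain ⟨-, s, t, hs, ht, hst, rfl⟩ := h
  refine ⟨t, ht, by linarith, ?_⟩
  obtain rfl : s = 1 - t := by linarith
  simp only [Finsupp.smul_single, smul_eq_mul, mul_one]

theorem OnCell.symm {a b : V} {x : V →₀ ℝ} (h : OnCell G a b x) : OnCell G b a x :=
  ⟨h.1.elim (fun h => .inl h.symm) (fun h => .inr h.symm), by rw [segment_symm]; exact h.2⟩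

theorem OnCell.nonneg {a b : V} {x : V →₀ ℝ} (h : OnCell G a b x) (c : V) : 0 ≤ x c := by
  classical
  obtain ⟨t, h0, h1, rfl⟩ := h.exists_eq
  simp only [Finsupp.add_apply, Finsupp.single_apply]
  split_ifs <;> linarith

theorem OnCell.le_one {a b : V} {x : V →₀ ℝ} (h : OnCell G a b x) (c : V) : x c ≤ 1 := by
  classical
  obtain ⟨t, h0, h1, rfl⟩ := h.exists_eq
  simp only [Finsupp.add_apply, Finsupp.single_apply]
  split_ifs <;> linarith

theorem OnCell.eq_or_eq {a b : V} {x : V →₀ ℝ} (h : OnCell G a b x) {c : V} (hc : x c ≠ 0) :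
    c = a ∨ c = b := by
  classical
  obtain ⟨t, h0, h1, rfl⟩ := h.exists_eq
  simp only [Finsupp.add_apply, Finsupp.single_apply] at hc
  by_contra! hne
  simp [hne.1.symm, hne.2.symm] at hc

theorem OnCell.sum_eq {a b : V} {x : V →₀ ℝ} (h : OnCell G a b x) (hab : a ≠ b) :
    x a + x b = 1 := by
  classical
  obtain ⟨t, h0, h1, rfl⟩ := h.exists_eq
  simp [hab, hab.symm]

theorem OnCell.self_eq {a : V} {x : V →₀ ℝ} (h : OnCell G a a x) : x a = 1 := by
  obtain ⟨t, h0, h1, rfl⟩ := h.exists_eq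
  simp

theorem OnCell.abs_eq {a b : V} {x y : V →₀ ℝ} (hx : OnCell G a b x) (hy : OnCell G a b y) :
    |x b - y b| = |x a - y a| := by
  by_cases hab : a = b
  · rw [hab]
  · have h1 := hx.sum_eq hab
    have h2 := hy.sum_eq hab
    rw [show x b - y b = -(x a - y a) by linarith, abs_neg]

theorem OnCell.abs_eq_of_ne {a b : V} {x y : V →₀ ℝ} (hx : OnCell G a b x) (hy : OnCell G a b y)
    {c : V} (hc : x c ≠ y c) : |x c - y c| = |x a - y a| := by
  have : c = a ∨ c = b := by
    by_cases h : x c = 0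
    · exact hy.eq_or_eq (fun h' => hc (h.trans h'.symm))
    · exact hx.eq_or_eq h
  rcases this with rfl | rfl
  · rfl
  · exact hx.abs_eq hy

theorem edist_le_of_ne_zero (x : MetricGraph G) {a b : V} (ha : x.1 a ≠ 0) (hb : x.1 b ≠ 0) :
    (G.edist a b : ℝ≥0∞) ≤ ENNReal.ofReal (1 - x.1 a) + ENNReal.ofReal (1 - x.1 b) := by
  obtain ⟨c, d, h⟩ := x.2
  by_cases hab : a = b
  · subst hab; simp
  have hcell : OnCell G a b x.1 := by
    rcases h.eq_or_eq ha with rfl | rfl <;> rcases h.eq_or_eq hb with rfl | rfl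
    · exact absurd rfl hab
    · exact h
    · exact h.symm
    · exact absurd rfl hab
  have hadj : G.Adj a b := hcell.1.resolve_left hab
  rw [SimpleGraph.edist_eq_one_iff_adj.2 hadj,
    ← ENNReal.ofReal_add (by linarith [h.le_one a]) (by linarith [h.le_one b]),
    show 1 - x.1 a + (1 - x.1 b) = 1 by linarith [hcell.sum_eq hab]]
  simp

theorem exists_slide (x y : MetricGraph G) {a b c : V} (hx : OnCell G a b x.1)
    (hy : OnCell G a b y.1) (hc : y.1 c ≠ 0) :
    ∃ f, x.1 f ≠ 0 ∧ ENNReal.ofReal (1 - x.1 f) + (G.edist f c : ℝ≥0∞) ≤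
      ENNReal.ofReal |x.1 a - y.1 a| + ENNReal.ofReal (1 - y.1 c) := by
  wlog hca : c = a generalizing a b
  · have := this hx.symm hy.symm ((hy.eq_or_eq hc).resolve_left hca)
    rwa [hx.abs_eq hy] at this
  subst hca
  by_cases hxc : x.1 c = 0
  · have hcb : c ≠ b := by
      rintro rfl
      have := hx.self_eq
      linarith
    have hb : x.1 b = 1 := by linarith [hx.sum_eq hcb]
    refine ⟨b, by rw [hb]; exact one_ne_zero, ?_⟩
    rw [hb, hxc, SimpleGraph.edist_eq_one_iff_adj.2 (hx.1.resolve_left hcb).symm,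
      ← ENNReal.ofReal_add (abs_nonneg _) (by linarith [hy.le_one c])]
    have : |0 - y.1 c| + (1 - y.1 c) = 1 := by
      rw [zero_sub, abs_neg, abs_of_nonneg (hy.nonneg c)]; ring
    rw [this]
    simp
  · refine ⟨c, hxc, ?_⟩
    rw [← ENNReal.ofReal_add (abs_nonneg _) (by linarith [hy.le_one c])]
    simp only [SimpleGraph.edist_self, ENat.toENNReal_zero, add_zero]
    apply ENNReal.ofReal_le_ofReal
    linarith [neg_abs_le (x.1 c - y.1 c)]

theorem IsPathLength.symm {x y : MetricGraph G} {r : ℝ≥0∞} (h : IsPathLength x y r) :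
    IsPathLength y x r := by
  cases h with
  | alongEdge a b hx hy => rw [abs_sub_comm]; exact .alongEdge a b hy hx
  | throughVertices a b ha hb =>
    rw [add_right_comm, add_comm (ENNReal.ofReal (1 - x.1 a)), add_right_comm,
      SimpleGraph.edist_comm]
    exact .throughVertices b a hb ha

theorem exists_le_of_slide {x y z : MetricGraph G} {a b : V} (hx : OnCell G a b x.1)
    (hy : OnCell G a b y.1) {c d : V} (hc : y.1 c ≠ 0) (hd : z.1 d ≠ 0) :
    ∃ t, IsPathLength x z t ∧ t ≤ ENNReal.ofReal |x.1 a - y.1 a| +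
      (ENNReal.ofReal (1 - y.1 c) + (G.edist c d : ℝ≥0∞) + ENNReal.ofReal (1 - z.1 d)) := by
  obtain ⟨f, hf, hle⟩ := exists_slide x y hx hy hc
  refine ⟨_, .throughVertices f d hf hd, ?_⟩
  have h : (G.edist f d : ℝ≥0∞) ≤ (G.edist f c : ℝ≥0∞) + (G.edist c d : ℝ≥0∞) := by
    rw [← ENat.toENNReal_add]
    exact ENat.toENNReal_le.2 SimpleGraph.edist_triangle
  calc _ ≤ ENNReal.ofReal (1 - x.1 f) + ((G.edist f c : ℝ≥0∞) + (G.edist c d : ℝ≥0∞))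
          + ENNReal.ofReal (1 - z.1 d) := by gcongr
    _ = (ENNReal.ofReal (1 - x.1 f) + (G.edist f c : ℝ≥0∞)) + (G.edist c d : ℝ≥0∞)
          + ENNReal.ofReal (1 - z.1 d) := by ring
    _ ≤ (ENNReal.ofReal |x.1 a - y.1 a| + ENNReal.ofReal (1 - y.1 c)) + (G.edist c d : ℝ≥0∞)
          + ENNReal.ofReal (1 - z.1 d) := by gcongr
    _ = _ := by ring

theorem IsPathLength.exists_le_add {x y z : MetricGraph G} {r s : ℝ≥0∞}
    (hr : IsPathLength x y r) (hs : IsPathLength y z s) :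
    ∃ t, IsPathLength x z t ∧ t ≤ r + s := by
  cases hr with
  | alongEdge a b hx hy =>
    cases hs with
    | alongEdge c d hy' hz =>
      by_cases hint : a ≠ b ∧ y.1 a ≠ 0 ∧ y.1 b ≠ 0
      · obtain ⟨hab, ha, hb⟩ := hint
        have key : OnCell G a b z.1 ∧ |y.1 c - z.1 c| = |y.1 a - z.1 a| := by
          rcases hy'.eq_or_eq ha with rfl | rfl <;> rcases hy'.eq_or_eq hb with rfl | rfl
          · exact absurd rfl hab
          · exact ⟨hz, rfl⟩
          · exact ⟨hz.symm, (hy'.abs_eq hz).symm⟩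
          · exact absurd rfl hab
        refine ⟨_, .alongEdge a b hx key.1, ?_⟩
        rw [key.2, ← ENNReal.ofReal_add (abs_nonneg _) (abs_nonneg _)]
        exact ENNReal.ofReal_le_ofReal (abs_sub_le _ _ _)
      · have he : ∃ e, y.1 e = 1 := by
          by_cases hab : a = b
          · subst hab; exact ⟨a, hy.self_eq⟩
          · have hsum := hy.sum_eq hab
            by_cases ha : y.1 a = 0
            · exact ⟨b, by linarith⟩
            · have hb : y.1 b = 0 := by
                by_contra hb
                exact hint ⟨hab, ha, hb⟩
              exact ⟨a, by linarith⟩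
        obtain ⟨e, he⟩ := he
        have hne : y.1 e ≠ 0 := by rw [he]; exact one_ne_zero
        obtain ⟨g, hg, hgle⟩ := exists_slide z y hz hy' hne
        obtain ⟨t, ht, hle⟩ := exists_le_of_slide hx hy hne hg
        refine ⟨t, ht, hle.trans ?_⟩
        gcongr
        rw [he, sub_self, ENNReal.ofReal_zero, add_zero, abs_sub_comm] at hgle
        rw [he, sub_self, ENNReal.ofReal_zero, zero_add, add_comm, SimpleGraph.edist_comm]
        exact hgle
    | throughVertices c d hc hd => exact exists_le_of_slide hx hy hc hd
  | throughVertices c d hc hd =>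
    cases hs with
    | alongEdge a b hy hz =>
      obtain ⟨t, ht, hle⟩ := exists_le_of_slide hz hy hd hc
      refine ⟨t, ht.symm, hle.trans (le_of_eq ?_)⟩
      rw [abs_sub_comm, SimpleGraph.edist_comm]
      ring
    | throughVertices c' d' hc' hd' =>
      refine ⟨_, .throughVertices c d' hc hd', ?_⟩
      have h1 : (G.edist c d' : ℝ≥0∞) ≤
          (G.edist c d : ℝ≥0∞) + ((G.edist d c' : ℝ≥0∞) + (G.edist c' d' : ℝ≥0∞)) := by
        rw [← ENat.toENNReal_add, ← ENat.toENNReal_add]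
        exact ENat.toENNReal_le.2
          (SimpleGraph.edist_triangle.trans (add_le_add le_rfl SimpleGraph.edist_triangle))
      have h2 := edist_le_of_ne_zero y hd hc'
      calc _ ≤ ENNReal.ofReal (1 - x.1 c) + ((G.edist c d : ℝ≥0∞) +
            ((ENNReal.ofReal (1 - y.1 d) + ENNReal.ofReal (1 - y.1 c'))
              + (G.edist c' d' : ℝ≥0∞))) + ENNReal.ofReal (1 - z.1 d') := by
            gcongr
            exact h1.trans (by gcongr)
        _ = _ := by ring

theorem eq_of_apply_eq_one {x y : MetricGraph G} {a : V} (hx : x.1 a = 1) (hy : y.1 a = 1) :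
    x = y := by
  have key : ∀ z : MetricGraph G, z.1 a = 1 → z.1 = Finsupp.single a 1 := by
    classical
    intro z hz
    obtain ⟨c, d, h⟩ := z.2
    ext e
    by_cases hea : e = a
    · subst hea; simp [hz]
    rw [Finsupp.single_eq_of_ne hea]
    by_contra hze
    have := edist_le_of_ne_zero z hze (b := a) (by rw [hz]; exact one_ne_zero)
    have hpos : (1 : ℝ≥0∞) ≤ (G.edist e a : ℝ≥0∞) := by
      rw [← ENat.toENNReal_one, ENat.toENNReal_le]
      exact Order.one_le_iff_pos.2 (SimpleGraph.edist_pos_of_ne hea)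
    have h2 := hpos.trans this
    rw [hz, sub_self, ENNReal.ofReal_zero, add_zero, ENNReal.one_le_ofReal] at h2
    exact hze (le_antisymm (by linarith) (h.nonneg e))
  exact Subtype.ext ((key x hx).trans (key y hy).symm)

theorem exists_pos_le_isPathLength {x y : MetricGraph G} (hxy : x ≠ y) :
    ∃ ε : ℝ≥0∞, 0 < ε ∧ ∀ r, IsPathLength x y r → ε ≤ r := by
  classical
  have hne : ∃ c, x.1 c ≠ y.1 c := by
    by_contra! h
    exact hxy (Subtype.ext (Finsupp.ext h))
  obtain ⟨c, hc⟩ := hne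
  let F : V × V → ℝ≥0∞ := fun p =>
    ENNReal.ofReal (1 - x.1 p.1) + (G.edist p.1 p.2 : ℝ≥0∞) + ENNReal.ofReal (1 - y.1 p.2)
  have hF : ∀ p : V × V, 0 < F p := by
    rintro ⟨a, b⟩
    rw [pos_iff_ne_zero]
    intro h
    simp only [F, add_eq_zero, ENNReal.ofReal_eq_zero, ENat.toENNReal_eq_zero,
      SimpleGraph.edist_eq_zero_iff] at h
    obtain ⟨⟨h1, rfl⟩, h2⟩ := h
    obtain ⟨_, _, hcx⟩ := x.2
    obtain ⟨_, _, hcy⟩ := y.2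
    exact hxy (eq_of_apply_eq_one (a := a) (by linarith [hcx.le_one a])
      (by linarith [hcy.le_one a]))
  refine ⟨min (ENNReal.ofReal |x.1 c - y.1 c|) ((x.1.support ×ˢ y.1.support).inf F), ?_, ?_⟩
  · refine lt_min (ENNReal.ofReal_pos.2 (abs_pos.2 (sub_ne_zero.2 hc))) ?_
    rw [Finset.lt_inf_iff ENNReal.zero_lt_top]
    exact fun p _ => hF p
  · intro r hr
    cases hr with
    | alongEdge a b hx hy =>
      rw [hx.abs_eq_of_ne hy hc]
      exact min_le_left _ _
    | throughVertices a b ha hb =>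
      exact (min_le_right _ _).trans
        (Finset.inf_le (f := F) (b := (a, b)) (by simp [ha, hb]))

/-- The distance of a metric graph: the length of a shortest path, and `⊤` for points in different
connected components. -/
noncomputable instance : EMetricSpace (MetricGraph G) where
  edist x y := sInf {r | IsPathLength x y r}
  edist_self x := by
    obtain ⟨a, b, h⟩ := x.2
    refine le_antisymm (sInf_le ?_) bot_le
    have := IsPathLength.alongEdge a b h h
    simpa using this
  edist_comm x y := by
    congr 1
    ext r
    exact ⟨IsPathLength.symm, IsPathLength.symm⟩
  edist_triangle x y z := by
    rw [ENNReal.sInf_add]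
    refine le_iInf₂ fun r hr => ?_
    rw [ENNReal.add_sInf]
    refine le_iInf₂ fun s hs => ?_
    obtain ⟨t, ht, hle⟩ := IsPathLength.exists_le_add hr hs
    exact (sInf_le ht).trans hle
  eq_of_edist_eq_zero {x y} h := by
    by_contra hxy
    obtain ⟨ε, hε, hle⟩ := exists_pos_le_isPathLength hxy
    exact (hε.trans_le (le_sInf hle)).ne' h

end Realization

section Hyperbolicity

variable {X : Type*} [EMetricSpace X]

/-- `S` is a geodesic joining `x` and `y`: the image of a curve `γ : [a, b] → X` from `x` to `y`
with `d (γ t) (γ s) = |t - s|`.  (Then `γ` restricted to `[t, s]` has length `|t - s|` as well.) -/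
def IsGeodesic (x y : X) (S : Set X) : Prop :=
  ∃ (a b : ℝ) (γ : ℝ → X), a ≤ b ∧ γ a = x ∧ γ b = y ∧ S = γ '' Set.Icc a b ∧
    ∀ s ∈ Set.Icc a b, ∀ t ∈ Set.Icc a b, edist (γ s) (γ t) = ENNReal.ofReal |s - t|

variable (X) in
/-- A geodesic triangle: three points, which need not be distinct, and three geodesics that join
them. -/
structure GeodesicTriangle where
  /-- the first vertex -/
  x : X
  /-- the second vertex -/
  y : X
  /-- the third vertex -/
  z : X
  /-- the side from `x` to `y` -/
  xy : Set X
  /-- the side from `y` to `z` -/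
  yz : Set X
  /-- the side from `z` to `x` -/
  zx : Set X
  isGeodesic_xy : IsGeodesic x y xy
  isGeodesic_yz : IsGeodesic y z yz
  isGeodesic_zx : IsGeodesic z x zx

/-- A triangle is `r`-thin if every side is contained in the (closed) `r`-neighbourhood of the
union of the two other sides. -/
def GeodesicTriangle.IsThin (T : GeodesicTriangle X) (r : ℝ≥0) : Prop :=
  (∀ p ∈ T.xy, Metric.infEDist p (T.yz ∪ T.zx) ≤ r) ∧
  (∀ p ∈ T.yz, Metric.infEDist p (T.zx ∪ T.xy) ≤ r) ∧
  (∀ p ∈ T.zx, Metric.infEDist p (T.xy ∪ T.yz) ≤ r)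

/-- The sharp thin constant `δ(T)` of a geodesic triangle. -/
noncomputable def GeodesicTriangle.delta (T : GeodesicTriangle X) : ℝ≥0∞ :=
  ⨅ (r : ℝ≥0) (_ : T.IsThin r), (r : ℝ≥0∞)

variable (X) in
/-- The sharp hyperbolicity constant `δ(X)`, the supremum of `δ(T)` over the geodesic triangles
of `X`.  A geodesic triangle lies in a single component of `X` (its points are at finite distance
from each other), so if `X` is not connected this is the supremum of the constants of its
components. -/
noncomputable def delta : ℝ≥0∞ := ⨆ T : GeodesicTriangle X, T.delta

end Hyperbolicity

/-- The hyperbolicity constant `δ(G)` of a graph `G`, all edges having length `1`. -/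
noncomputable def graphDelta {V : Type*} (G : SimpleGraph V) : ℝ≥0∞ := delta (MetricGraph G)

end GraphHyperbolicity

/-! Every edge of `P_m × P_n` changes both coordinates by one. Hence coordinate differences of
vertices in one component have equal parity, and the distance is the larger of the two: the
coordinate that arrives early oscillates. The first coordinate extends affinely to a 1-Lipschitz
function `F` on the metric graph, and `d(x, y) ≤ max |F x - F y| r` with `r = n - 1`, or even `r =
0` if `n = 2` (`edist_directProduct_le_max`).

Upper bounds. Up to scale `r` the space is a piece of the line, so `δ ≤ r`: an intermediate value
argument finds, on the other two sides, a point at the same level of `F`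
(`delta_le_of_edist_le_max`). Also, components have diameter at most `m - 1`, and `δ` is at most
half the diameter (`delta_le_half_of_edist_le`).

Lower bound. If `2k + 1 ≤ m` and `k + 2 ≤ n`, join `(0, 1)` to `(2k, 1)` by a walk that climbs to
height `1 + k` and comes back, and by a zigzag in rows `0` and `1`. The first coordinate grows at
unit speed on both, so they are geodesics; the second coordinate, also 1-Lipschitz, keeps the peak
at distance at least `k` from the zigzag. For `m = 2k + 1 ≤ 2n - 3` this meets the diameter bound.
-/

namespace GraphHyperbolicity

/-! ### Affine extensions of vertex functions and basic distance estimates. -/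

section LinearExtension

variable {V : Type*} {G : SimpleGraph V}

/-- The point of the metric graph that a vertex is. -/
noncomputable def vertexPoint (G : SimpleGraph V) (a : V) : MetricGraph G :=
  ⟨Finsupp.single a 1, a, a, .inl rfl, left_mem_segment ℝ _ _⟩

/-- The extension of a function on the vertices that is affine on every edge. -/
noncomputable def affineExtension (f : V → ℝ) (x : MetricGraph G) : ℝ :=
  Finsupp.linearCombination ℝ f x.1

theorem OnCell.affineExtension_eq {x : MetricGraph G} {a b : V} (h : OnCell G a b x.1)
    (f : V → ℝ) : affineExtension f x = x.1 a * f a + (1 - x.1 a) * f b := by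
  obtain ⟨t, -, -, ht⟩ := h.exists_eq
  by_cases hab : a = b
  · subst hab
    rw [h.self_eq, affineExtension, ht]
    simp
  · have : x.1 a = 1 - t := by rw [ht]; simp [hab]
    rw [this, affineExtension, ht]
    simp
    ring

theorem affineExtension_le {f : V → ℝ} {C : ℝ} {x : MetricGraph G} {a b : V}
    (h : OnCell G a b x.1) (ha : f a ≤ C) (hb : f b ≤ C) : affineExtension f x ≤ C := by
  rw [h.affineExtension_eq]
  nlinarith [h.nonneg a, h.le_one a]

theorem exists_onCell_of_ne_zero (x : MetricGraph G) {a : V} (ha : x.1 a ≠ 0) :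
    ∃ b, OnCell G a b x.1 := by
  obtain ⟨c, d, h⟩ := x.2
  rcases h.eq_or_eq ha with rfl | rfl
  · exact ⟨d, h⟩
  · exact ⟨c, h.symm⟩

theorem abs_sub_le_edist {f : V → ℝ} (hf : ∀ a b, G.Adj a b → |f a - f b| ≤ 1) (a b : V) :
    ENNReal.ofReal |f a - f b| ≤ (G.edist a b : ℝ≥0∞) := by
  by_cases h : G.Reachable a b
  · obtain ⟨w, hw⟩ := h.exists_walk_length_eq_edist
    rw [← hw]
    have : ∀ {a b : V} (w : G.Walk a b), |f a - f b| ≤ w.length := by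
      intro a b w
      induction w with
      | nil => simp
      | cons hadj w ih =>
        rw [SimpleGraph.Walk.length_cons]
        push_cast
        linarith [hf _ _ hadj, abs_sub_le (f _) (f _) (f _) |>.trans
          (add_le_add (hf _ _ hadj) ih)]
    refine (ENNReal.ofReal_le_ofReal (this w)).trans ?_
    simp
  · rw [SimpleGraph.edist_eq_top_of_not_reachable h]
    simp

/-- The source of all lower bounds on distances: each candidate path length dominates the variation
of `f` along its pieces. -/
theorem abs_affineExtension_sub_le {f : V → ℝ} (hf : ∀ a b, G.Adj a b → |f a - f b| ≤ 1)
    (x y : MetricGraph G) :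
    ENNReal.ofReal |affineExtension f x - affineExtension f y| ≤ edist x y := by
  have hcell : ∀ {a b : V}, (a = b ∨ G.Adj a b) → |f a - f b| ≤ 1 := by
    rintro a b (rfl | h)
    · simp
    · exact hf _ _ h
  have key : ∀ (z : MetricGraph G) {a : V}, z.1 a ≠ 0 →
      |affineExtension f z - f a| ≤ 1 - z.1 a := by
    intro z a ha
    obtain ⟨b, h⟩ := exists_onCell_of_ne_zero z ha
    rw [h.affineExtension_eq, show z.1 a * f a + (1 - z.1 a) * f b - f a
      = -((1 - z.1 a) * (f a - f b)) by ring, abs_neg, abs_mul,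
      abs_of_nonneg (by linarith [h.le_one a])]
    nlinarith [hcell h.1, h.le_one a]
  refine le_sInf fun r hr => ?_
  cases hr with
  | alongEdge a b hx hy =>
    apply ENNReal.ofReal_le_ofReal
    rw [hx.affineExtension_eq, hy.affineExtension_eq,
      show x.1 a * f a + (1 - x.1 a) * f b - (y.1 a * f a + (1 - y.1 a) * f b)
        = (x.1 a - y.1 a) * (f a - f b) by ring, abs_mul]
    nlinarith [hcell hx.1, abs_nonneg (x.1 a - y.1 a)]
  | throughVertices a b ha hb =>
    have h1 := key x ha
    have h2 := key y hb
    rw [abs_sub_comm] at h2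
    calc _ ≤ ENNReal.ofReal ((1 - x.1 a) + |f a - f b| + (1 - y.1 b)) := by
          apply ENNReal.ofReal_le_ofReal
          have := abs_sub_le (affineExtension f x) (f a) (affineExtension f y)
          have := abs_sub_le (f a) (f b) (affineExtension f y)
          linarith
      _ = ENNReal.ofReal (1 - x.1 a) + ENNReal.ofReal |f a - f b|
            + ENNReal.ofReal (1 - y.1 b) := by
          have := (abs_nonneg _).trans h1
          have := (abs_nonneg _).trans h2
          rw [ENNReal.ofReal_add (by positivity) (by assumption),
            ENNReal.ofReal_add (by assumption) (by positivity)]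
      _ ≤ _ := by gcongr; exact abs_sub_le_edist hf a b

theorem edist_vertexPoint_le {x : MetricGraph G} {a b : V} (h : OnCell G a b x.1) :
    edist x (vertexPoint G a) ≤ ENNReal.ofReal (1 - x.1 a) := by
  refine sInf_le ?_
  have := IsPathLength.alongEdge (x := x) (y := vertexPoint G a) a b h
    ⟨h.1, left_mem_segment ℝ _ _⟩
  rwa [show (vertexPoint G a).1 a = 1 by simp [vertexPoint], abs_sub_comm,
    abs_of_nonneg (by linarith [h.le_one a])] at this

theorem edist_vertexPoint_vertexPoint_le (a b : V) :
    edist (vertexPoint G a) (vertexPoint G b) ≤ (G.edist a b : ℝ≥0∞) := by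
  refine sInf_le ?_
  have := IsPathLength.throughVertices (x := vertexPoint G a) (y := vertexPoint G b) a b
    (by simp [vertexPoint]) (by simp [vertexPoint])
  simpa [vertexPoint] using this

theorem edist_le_of_onCell {x y : MetricGraph G} {a b c d : V} {N : ℕ} (hx : OnCell G a b x.1)
    (hy : OnCell G c d y.1) (h : G.edist a c ≤ N) :
    edist x y ≤ ENNReal.ofReal ((1 - x.1 a) + N + (1 - y.1 c)) := by
  have h1 : (0 : ℝ) ≤ 1 - x.1 a := by linarith [hx.le_one a]
  have h2 : (0 : ℝ) ≤ 1 - y.1 c := by linarith [hy.le_one c]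
  rw [ENNReal.ofReal_add (by positivity) h2, ENNReal.ofReal_add h1 (by positivity),
    ENNReal.ofReal_natCast]
  refine (edist_triangle4 x (vertexPoint G a) (vertexPoint G c) y).trans ?_
  gcongr
  · exact edist_vertexPoint_le hx
  · refine (edist_vertexPoint_vertexPoint_le a c).trans ?_
    exact_mod_cast ENat.toENNReal_le.2 h
  · rw [edist_comm]
    exact edist_vertexPoint_le hy

theorem edist_le_of_onCell_of_onCell {x y : MetricGraph G} {a b : V} (hx : OnCell G a b x.1)
    (hy : OnCell G a b y.1) : edist x y ≤ ENNReal.ofReal |x.1 a - y.1 a| :=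
  sInf_le (.alongEdge a b hx hy)

theorem reachable_of_onCell {a b : V} {x : V →₀ ℝ} (h : OnCell G a b x) : G.Reachable a b := by
  rcases h.1 with rfl | h
  · exact .rfl
  · exact h.reachable

/-- Finite distance passes from the points to the chosen ends of their cells, where some candidate
path has finite length. -/
theorem reachable_of_edist_ne_top {x y : MetricGraph G} {a b c d : V} (hx : OnCell G a b x.1)
    (hy : OnCell G c d y.1) (h : edist x y ≠ ⊤) : G.Reachable a c := by
  have hlt : edist (vertexPoint G a) (vertexPoint G c) < ⊤ := by
    refine (edist_triangle4 _ x y _).trans_lt ?_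
    rw [edist_comm _ x]
    exact ENNReal.add_lt_top.2 ⟨ENNReal.add_lt_top.2
      ⟨(edist_vertexPoint_le hx).trans_lt ENNReal.ofReal_lt_top, h.lt_top⟩,
      (edist_vertexPoint_le hy).trans_lt ENNReal.ofReal_lt_top⟩
  obtain ⟨r, hr, hlt⟩ := sInf_lt_iff.1 hlt
  cases hr with
  | alongEdge p q hp hq =>
    have h1 : G.Reachable a p := by
      rcases hp.eq_or_eq (c := a) (by simp [vertexPoint]) with rfl | rfl
      · exact .rfl
      · exact (reachable_of_onCell hp).symm
    have h2 : G.Reachable c p := by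
      rcases hq.eq_or_eq (c := c) (by simp [vertexPoint]) with rfl | rfl
      · exact .rfl
      · exact (reachable_of_onCell hq).symm
    exact h1.trans h2.symm
  | throughVertices p q hp hq =>
    have hp : a = p := by
      by_contra hne
      exact hp (Finsupp.single_eq_of_ne (Ne.symm hne))
    have hq : c = q := by
      by_contra hne
      exact hq (Finsupp.single_eq_of_ne (Ne.symm hne))
    subst hp hq
    by_contra hn
    rw [SimpleGraph.edist_eq_top_of_not_reachable hn] at hlt
    simp at hlt

end LinearExtension

/-! ### Geodesics and upper bounds for the hyperbolicity constant. -/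

section Thin

variable {X : Type*} [EMetricSpace X]

theorem IsGeodesic.left_mem {x y : X} {S : Set X} (h : IsGeodesic x y S) : x ∈ S := by
  obtain ⟨a, b, γ, hab, rfl, rfl, rfl, -⟩ := h
  exact ⟨a, Set.left_mem_Icc.2 hab, rfl⟩

theorem IsGeodesic.right_mem {x y : X} {S : Set X} (h : IsGeodesic x y S) : y ∈ S := by
  obtain ⟨a, b, γ, hab, rfl, rfl, rfl, -⟩ := h
  exact ⟨b, Set.right_mem_Icc.2 hab, rfl⟩

theorem IsGeodesic.edist_ne_top {x y p q : X} {S : Set X} (h : IsGeodesic x y S) (hp : p ∈ S)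
    (hq : q ∈ S) : edist p q ≠ ⊤ := by
  obtain ⟨a, b, γ, hab, rfl, rfl, rfl, hγ⟩ := h
  obtain ⟨s, hs, rfl⟩ := hp
  obtain ⟨t, ht, rfl⟩ := hq
  rw [hγ s hs t ht]
  exact ENNReal.ofReal_ne_top

theorem IsGeodesic.exists_edist_eq {x y p : X} {S : Set X} (h : IsGeodesic x y S) (hp : p ∈ S) :
    ∃ u v : ℝ, 0 ≤ u ∧ 0 ≤ v ∧ edist x p = ENNReal.ofReal u ∧ edist p y = ENNReal.ofReal v ∧
      edist x y = ENNReal.ofReal (u + v) := by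
  obtain ⟨a, b, γ, hab, rfl, rfl, rfl, hγ⟩ := h
  obtain ⟨t, ht, rfl⟩ := hp
  have ha := Set.left_mem_Icc.2 hab
  have hb := Set.right_mem_Icc.2 hab
  refine ⟨t - a, b - t, by linarith [ht.1], by linarith [ht.2], ?_, ?_, ?_⟩
  · rw [hγ a ha t ht, abs_sub_comm, abs_of_nonneg (by linarith [ht.1])]
  · rw [hγ t ht b hb, abs_sub_comm, abs_of_nonneg (by linarith [ht.2])]
  · rw [hγ a ha b hb, abs_sub_comm, abs_of_nonneg (by linarith), sub_add_sub_cancel']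

theorem IsGeodesic.isPreconnected {x y : X} {S : Set X} (h : IsGeodesic x y S) :
    IsPreconnected S := by
  obtain ⟨a, b, γ, hab, rfl, rfl, rfl, hγ⟩ := h
  refine isPreconnected_Icc.image γ ?_
  have : LipschitzOnWith 1 γ (Set.Icc a b) := by
    intro s hs t ht
    rw [hγ s hs t ht, edist_dist, Real.dist_eq]
    simp
  exact this.continuousOn

theorem delta_le_of_forall_infEDist_le {r : ℝ≥0}
    (h : ∀ (x y z : X) (S₁ S₂ S₃ : Set X), IsGeodesic x y S₁ → IsGeodesic y z S₂ →
      IsGeodesic z x S₃ → ∀ p ∈ S₁, Metric.infEDist p (S₂ ∪ S₃) ≤ r) : delta X ≤ r := by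
  refine iSup_le fun T => iInf₂_le r ⟨?_, ?_, ?_⟩
  · exact h _ _ _ _ _ _ T.isGeodesic_xy T.isGeodesic_yz T.isGeodesic_zx
  · exact h _ _ _ _ _ _ T.isGeodesic_yz T.isGeodesic_zx T.isGeodesic_xy
  · exact h _ _ _ _ _ _ T.isGeodesic_zx T.isGeodesic_xy T.isGeodesic_yz

/-- A point of a side of length at most `D` is within `D / 2` of an end of that side, and each end
lies on another side. -/
theorem delta_le_half_of_edist_le {D : ℝ} (hD0 : 0 ≤ D)
    (hD : ∀ x y : X, edist x y ≠ ⊤ → edist x y ≤ ENNReal.ofReal D) :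
    delta X ≤ ENNReal.ofReal (D / 2) := by
  refine delta_le_of_forall_infEDist_le fun x y z S₁ S₂ S₃ h₁ h₂ h₃ p hp => ?_
  change _ ≤ ENNReal.ofReal (D / 2)
  obtain ⟨u, v, hu, hv, hxp, hpy, hxy⟩ := h₁.exists_edist_eq hp
  have := hD x y (by rw [hxy]; exact ENNReal.ofReal_ne_top)
  rw [hxy, ENNReal.ofReal_le_ofReal_iff hD0] at this
  rcases le_total u v with huv | huv
  · refine (Metric.infEDist_le_edist_of_mem (.inr h₃.right_mem)).trans ?_
    rw [edist_comm, hxp]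
    exact ENNReal.ofReal_le_ofReal (by linarith)
  · refine (Metric.infEDist_le_edist_of_mem (.inl h₂.left_mem)).trans ?_
    rw [hpy]
    exact ENNReal.ofReal_le_ofReal (by linarith)

/-- A space that is, up to distances at most `r`, isometric to a subset of the line, is
`r`-hyperbolic. -/
theorem delta_le_of_edist_le_max {r : ℝ≥0} (F : X → ℝ)
    (hF : ∀ x y, ENNReal.ofReal |F x - F y| ≤ edist x y)
    (h : ∀ x y, edist x y ≠ ⊤ → edist x y ≤ ENNReal.ofReal (max |F x - F y| r)) :
    delta X ≤ r := by
  have hcont : Continuous F := by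
    have : LipschitzWith 1 F := fun x y => by
      rw [edist_dist, Real.dist_eq]
      simpa using hF x y
    exact this.continuous
  refine delta_le_of_forall_infEDist_le fun x y z S₁ S₂ S₃ h₁ h₂ h₃ p hp => ?_
  by_contra! hlt
  have hall : ∀ q ∈ S₂ ∪ S₃, (r : ℝ≥0∞) < edist p q := fun q hq =>
    hlt.trans_le (Metric.infEDist_le_edist_of_mem hq)
  -- Beyond scale `r` the two bounds force `F` to preserve distances.
  have hfar : ∀ {q q' : X} {w : ℝ}, 0 ≤ w → edist q q' = ENNReal.ofReal w → (r : ℝ) < w →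
      |F q - F q'| = w := by
    intro q q' w hw he hrw
    have h1 := hF q q'
    have h2 := h q q' (by rw [he]; exact ENNReal.ofReal_ne_top)
    rw [he, ENNReal.ofReal_le_ofReal_iff hw] at h1
    rw [he, ENNReal.ofReal_le_ofReal_iff (by positivity)] at h2
    rcases le_max_iff.1 h2 with h2 | h2 <;> linarith
  obtain ⟨u, v, hu, hv, hxp, hpy, hxy⟩ := h₁.exists_edist_eq hp
  have hru : (r : ℝ) < u := by
    have := hall x (.inr h₃.right_mem)
    rw [edist_comm, hxp, ← ENNReal.ofReal_coe_nnreal] at this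
    exact (ENNReal.ofReal_lt_ofReal_iff_of_nonneg r.2).1 this
  have hrv : (r : ℝ) < v := by
    have := hall y (.inl h₂.left_mem)
    rw [hpy, ← ENNReal.ofReal_coe_nnreal] at this
    exact (ENNReal.ofReal_lt_ofReal_iff_of_nonneg r.2).1 this
  have e1 := hfar hu hxp hru
  have e2 := hfar hv hpy hrv
  have e3 := hfar (by positivity) hxy (by linarith)
  -- The `F`-distances `x` to `p` and `p` to `y` add up to that from `x` to `y`, which on the line
  -- means betweenness.
  have hbetween : F p ∈ Set.uIcc (F x) (F y) := by
    rw [Set.mem_uIcc]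
    rcases abs_cases (F x - F p) with ⟨a1, -⟩ | ⟨a1, -⟩ <;>
    rcases abs_cases (F p - F y) with ⟨a2, -⟩ | ⟨a2, -⟩ <;>
    rcases abs_cases (F x - F y) with ⟨a3, -⟩ | ⟨a3, -⟩ <;>
    first
    | (left; constructor <;> linarith)
    | (right; constructor <;> linarith)
  have hconn : IsPreconnected (F '' (S₂ ∪ S₃)) :=
    (h₂.isPreconnected.union z h₂.right_mem h₃.left_mem h₃.isPreconnected).image F
      hcont.continuousOn
  -- Intermediate values: `S₂ ∪ S₃` is connected through `z` and contains `x` and `y`. The point `q`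
  -- on the level of `p` is then within `r` of `p`.
  obtain ⟨q, hq, hFq⟩ := hconn.ordConnected.uIcc_subset
    (Set.mem_image_of_mem F (Or.inr h₃.right_mem)) (Set.mem_image_of_mem F (Or.inl h₂.left_mem))
    hbetween
  have htop : edist p q ≠ ⊤ := by
    rcases hq with hq | hq
    · exact ((edist_triangle p y q).trans_lt (ENNReal.add_lt_top.2
        ⟨(h₁.edist_ne_top hp h₁.right_mem).lt_top, (h₂.edist_ne_top h₂.left_mem hq).lt_top⟩)).ne
    · exact ((edist_triangle p x q).trans_lt (ENNReal.add_lt_top.2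
        ⟨(h₁.edist_ne_top hp h₁.left_mem).lt_top, (h₃.edist_ne_top h₃.right_mem hq).lt_top⟩)).ne
  refine (hall q hq).not_ge ((h p q htop).trans ?_)
  rw [hFq, sub_self, abs_zero, max_eq_right r.coe_nonneg, ENNReal.ofReal_coe_nnreal]

end Thin

/-! ### From distances of vertices to distances of points. -/

section Grading

variable {V : Type*} {G : SimpleGraph V}

/-- Without isolated vertices, a vertex can be placed on a genuine edge too, which removes the
degenerate cells from the case analysis below. -/
theorem exists_ascending_cell {f : V → ℤ}
    (hf : ∀ a b, G.Adj a b → f b = f a + 1 ∨ f a = f b + 1) (hG : ∀ a, ∃ b, G.Adj a b)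
    (x : MetricGraph G) : ∃ a b, a ≠ b ∧ f b = f a + 1 ∧ OnCell G a b x.1 := by
  have key : ∀ a b, G.Adj a b → OnCell G a b x.1 →
      ∃ a b, a ≠ b ∧ f b = f a + 1 ∧ OnCell G a b x.1 := by
    intro a b hab h
    rcases hf a b hab with h1 | h1
    · exact ⟨a, b, hab.ne, h1, h⟩
    · exact ⟨b, a, hab.ne', h1, h.symm⟩
  obtain ⟨a, b, h⟩ := x.2
  rcases h.1 with rfl | hab
  · obtain ⟨b, hab⟩ := hG a
    refine key a b hab ⟨.inr hab, ?_⟩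
    have := h.2
    rw [segment_same, Set.mem_singleton_iff] at this
    rw [this]
    exact left_mem_segment ℝ _ _
  · exact key a b hab h

/-- If the vertices of `G` are graded by `f`, and their distances are bounded by `max |Δf| r`, then
so are the distances of all points. -/
theorem edist_le_max_of_grading {f : V → ℤ}
    (hf : ∀ a b, G.Adj a b → f b = f a + 1 ∨ f a = f b + 1) (hG : ∀ a, ∃ b, G.Adj a b) {r : ℕ}
    (hdist : ∀ a c, G.Reachable a c → ∃ N : ℕ, G.edist a c ≤ N ∧ Even ((N : ℤ) - (f a - f c)) ∧
      (N : ℤ) ≤ max |f a - f c| r)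
    (x y : MetricGraph G) (hxy : edist x y ≠ ⊤) :
    edist x y ≤ ENNReal.ofReal
      (max |affineExtension (fun a => (f a : ℝ)) x - affineExtension (fun a => (f a : ℝ)) y| r) := by
  obtain ⟨a, b, hab, hfab, hx⟩ := exists_ascending_cell hf hG x
  obtain ⟨c, d, hcd, hfcd, hy⟩ := exists_ascending_cell hf hG y
  wlog hle : f a ≤ f c generalizing x y a b c d
  · rw [edist_comm, abs_sub_comm]
    exact this y x (by rwa [edist_comm]) c d hcd hfcd hy a b hab hfab hx (by omega)
  have hFx : affineExtension (fun a => (f a : ℝ)) x = f a + 1 - x.1 a := by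
    rw [hx.affineExtension_eq, hfab]; push_cast; ring
  have hFy : affineExtension (fun a => (f a : ℝ)) y = f c + 1 - y.1 c := by
    rw [hy.affineExtension_eq, hfcd]; push_cast; ring
  rw [hFx, hFy]
  have hxb := hx.sum_eq hab
  have hyd := hy.sum_eq hcd
  -- Four routes join the ends of the two edges: `a` to `c`, `b` to `d`, `a` to `d`, `b` to `c`.
  obtain ⟨N₁, d₁, p₁, b₁⟩ := hdist a c (reachable_of_edist_ne_top hx hy hxy)
  obtain ⟨N₂, d₂, p₂, b₂⟩ := hdist b d (reachable_of_edist_ne_top hx.symm hy.symm hxy)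
  obtain ⟨N₃, d₃, p₃, b₃⟩ := hdist a d (reachable_of_edist_ne_top hx hy.symm hxy)
  obtain ⟨N₄, d₄, p₄, b₄⟩ := hdist b c (reachable_of_edist_ne_top hx.symm hy hxy)
  have e₁ := edist_le_of_onCell hx hy d₁
  have e₂ := edist_le_of_onCell hx.symm hy.symm d₂
  have e₃ := edist_le_of_onCell hx hy.symm d₃
  have e₄ := edist_le_of_onCell hx.symm hy d₄
  obtain ⟨k, hk0⟩ := Int.eq_ofNat_of_zero_le (sub_nonneg.2 hle)
  rw [show f a - f c = -k by omega, abs_neg, Nat.abs_cast] at b₁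
  rw [show f b - f d = -k by omega, abs_neg, Nat.abs_cast] at b₂
  rw [show f a - f d = -(k + 1 : ℕ) by omega, abs_neg, Nat.abs_cast] at b₃
  rw [show f b - f c = 1 - k by omega, abs_eq_max_neg] at b₄
  rw [Int.even_iff] at p₁ p₂ p₃ p₄
  by_cases hk : k + 1 ≤ r
  -- By parity, one of the pairs `N₁, N₂` and `N₃, N₄` consists of numbers at most `r - 1`. The two
  -- routes of that pair use complementary parts of both edges, so their lengths add up to at most
  -- `2 * r` and one of them is at most `r`.
  · by_cases hpar : (r + k) % 2 = 0
    · have l₃ : ((N₃ + 1 : ℕ) : ℝ) ≤ r := Nat.cast_le.2 (by omega)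
      have l₄ : ((N₄ + 1 : ℕ) : ℝ) ≤ r := Nat.cast_le.2 (by omega)
      push_cast at l₃ l₄
      rcases le_total (x.1 a) (y.1 c) with h | h
      · exact e₄.trans (ENNReal.ofReal_le_ofReal (le_max_of_le_right (by linarith)))
      · exact e₃.trans (ENNReal.ofReal_le_ofReal (le_max_of_le_right (by linarith)))
    · have l₁ : ((N₁ + 1 : ℕ) : ℝ) ≤ r := Nat.cast_le.2 (by omega)
      have l₂ : ((N₂ + 1 : ℕ) : ℝ) ≤ r := Nat.cast_le.2 (by omega)
      push_cast at l₁ l₂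
      rcases le_total (x.1 a + y.1 c) 1 with h | h
      · exact e₂.trans (ENNReal.ofReal_le_ofReal (le_max_of_le_right (by linarith)))
      · exact e₁.trans (ENNReal.ofReal_le_ofReal (le_max_of_le_right (by linarith)))
  -- Here `k = 0` forces `r = 0`, so both points lie on one edge.
  · by_cases h0 : k = 0
    · have hac : a = c := by
        rw [show N₁ = 0 by omega] at d₁
        simpa using d₁
      have hbd : b = d := by
        rw [show N₂ = 0 by omega] at d₂
        simpa using d₂
      subst hac hbd
      refine (edist_le_of_onCell_of_onCell hx hy).trans
        (ENNReal.ofReal_le_ofReal (le_max_of_le_left (le_of_eq ?_)))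
      rw [abs_sub_comm]
      congr 1
      ring
    -- The ascending route from `b` to `c` takes at most `k - 1` steps (parity excludes `k` when `r
    -- = k`), so its length is at most the difference of levels.
    · have l₄ : ((N₄ + 1 : ℤ) : ℝ) ≤ ((f c - f a : ℤ) : ℝ) := Int.cast_le.2 (by omega)
      push_cast at l₄
      refine e₄.trans (ENNReal.ofReal_le_ofReal (le_max_of_le_left ?_))
      rw [abs_sub_comm]
      refine le_trans ?_ (le_abs_self _)
      linarith

end Grading

/-! ### Distances in the product of two paths and the upper bounds. -/

section Product

variable {m n : ℕ}

/-- Step towards `j`, or anywhere if `i = j`: parity then leaves at least one more step in which to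
return. -/
theorem exists_pathGraph_adj_closer (hm : 2 ≤ m) {N : ℕ} (i j : Fin m)
    (hle : |(i : ℤ) - j| ≤ N + 1) (hpar : Even ((N + 1 : ℤ) - (i - j))) :
    ∃ k, (SimpleGraph.pathGraph m).Adj i k ∧ |(k : ℤ) - j| ≤ N ∧ Even ((N : ℤ) - (k - j)) := by
  simp only [SimpleGraph.pathGraph_adj, abs_le, Int.even_iff] at *
  have hi := i.2
  have hj := j.2
  by_cases h : (i : ℕ) + 1 < m ∧ ((i : ℕ) ≤ j)
  · refine ⟨⟨i + 1, h.1⟩, .inl rfl, ?_⟩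
    push_cast
    omega
  · refine ⟨⟨i - 1, by omega⟩, .inr ?_, ?_⟩
    · change (i : ℕ) - 1 + 1 = i
      omega
    · have : ((i - 1 : ℕ) : ℤ) = i - 1 := by omega
      simp only [this]
      omega

/-- Both coordinates must move at every step, so a common number of steps suits both exactly when it
is large enough and has the right parity for each. -/
theorem edist_directProduct_pathGraph_le (hm : 2 ≤ m) (hn : 2 ≤ n) (N : ℕ) (p q : Fin m × Fin n)
    (h₁ : |(p.1 : ℤ) - q.1| ≤ N) (e₁ : Even ((N : ℤ) - (p.1 - q.1)))
    (h₂ : |(p.2 : ℤ) - q.2| ≤ N) (e₂ : Even ((N : ℤ) - (p.2 - q.2))) :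
    (directProduct (SimpleGraph.pathGraph m) (SimpleGraph.pathGraph n)).edist p q ≤ N := by
  induction N generalizing p with
  | zero =>
    have : p = q := by
      rw [abs_le] at h₁ h₂
      apply Prod.ext <;> apply Fin.ext <;> omega
    simp [this]
  | succ N ih =>
    obtain ⟨k, hk, a₁, b₁⟩ := exists_pathGraph_adj_closer hm p.1 q.1 (by exact_mod_cast h₁)
      (by exact_mod_cast e₁)
    obtain ⟨l, hl, a₂, b₂⟩ := exists_pathGraph_adj_closer hn p.2 q.2 (by exact_mod_cast h₂)
      (by exact_mod_cast e₂)
    have hadj : (directProduct (SimpleGraph.pathGraph m) (SimpleGraph.pathGraph n)).Adj p (k, l) :=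
      ⟨hk, hl⟩
    refine SimpleGraph.edist_triangle.trans
      ((add_le_add (SimpleGraph.edist_eq_one_iff_adj.2 hadj).le (ih (k, l) a₁ b₁ a₂ b₂)).trans ?_)
    rw [add_comm]
    push_cast
    exact le_rfl

theorem directProduct_pathGraph_adj_fst {p q : Fin m × Fin n}
    (h : (directProduct (SimpleGraph.pathGraph m) (SimpleGraph.pathGraph n)).Adj p q) :
    (q.1 : ℤ) = p.1 + 1 ∨ (p.1 : ℤ) = q.1 + 1 := by
  have := SimpleGraph.pathGraph_adj.1 h.1
  omega

theorem directProduct_pathGraph_adj_snd {p q : Fin m × Fin n}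
    (h : (directProduct (SimpleGraph.pathGraph m) (SimpleGraph.pathGraph n)).Adj p q) :
    (q.2 : ℤ) = p.2 + 1 ∨ (p.2 : ℤ) = q.2 + 1 := by
  have := SimpleGraph.pathGraph_adj.1 h.2
  omega

theorem even_of_reachable {p q : Fin m × Fin n}
    (h : (directProduct (SimpleGraph.pathGraph m) (SimpleGraph.pathGraph n)).Reachable p q) :
    Even (((p.1 : ℤ) - q.1) - (p.2 - q.2)) := by
  obtain ⟨w⟩ := h
  induction w with
  | nil => simp
  | cons hadj w ih =>
    have h₁ := directProduct_pathGraph_adj_fst hadj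
    have h₂ := directProduct_pathGraph_adj_snd hadj
    rw [Int.even_iff] at *
    omega

theorem exists_directProduct_pathGraph_adj (hm : 2 ≤ m) (hn : 2 ≤ n) (p : Fin m × Fin n) :
    ∃ q, (directProduct (SimpleGraph.pathGraph m) (SimpleGraph.pathGraph n)).Adj p q := by
  have key : ∀ {k : ℕ}, 2 ≤ k → ∀ i : Fin k, ∃ j, (SimpleGraph.pathGraph k).Adj i j := by
    intro k hk i
    obtain ⟨j, hj, -⟩ := exists_pathGraph_adj_closer (N := 1) hk i i (by simp) (by simp)
    exact ⟨j, hj⟩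
  obtain ⟨k, hk⟩ := key hm p.1
  obtain ⟨l, hl⟩ := key hn p.2
  exact ⟨(k, l), hk, hl⟩

/-- The distance of the vertices is the maximum of the distances of their coordinates. -/
theorem exists_edist_le_max (hm : 2 ≤ m) (hn : 2 ≤ n) {r : ℕ}
    (hr : n ≤ r + 1 ∨ n = 2) (p q : Fin m × Fin n)
    (h : (directProduct (SimpleGraph.pathGraph m) (SimpleGraph.pathGraph n)).Reachable p q) :
    ∃ N : ℕ, (directProduct (SimpleGraph.pathGraph m) (SimpleGraph.pathGraph n)).edist p q ≤ N ∧
      Even ((N : ℤ) - ((p.1 : ℤ) - q.1)) ∧ (N : ℤ) ≤ max |(p.1 : ℤ) - q.1| r := by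
  have he := even_of_reachable h
  have hp := p.2.2
  have hq := q.2.2
  rw [Int.even_iff] at he
  -- If `n = 2`, a second difference `±1` forces the first to be odd, so the first always attains
  -- the maximum and any `r` will do.
  refine ⟨max ((p.1 : ℤ) - q.1).natAbs ((p.2 : ℤ) - q.2).natAbs,
    edist_directProduct_pathGraph_le hm hn _ p q ?_ ?_ ?_ ?_, ?_, ?_⟩ <;>
  simp only [Int.even_iff, abs_le, le_max_iff, le_abs] <;> omega

theorem edist_directProduct_le_max (hm : 2 ≤ m) (hn : 2 ≤ n) {r : ℕ} (hr : n ≤ r + 1 ∨ n = 2)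
    (x y : MetricGraph (directProduct (SimpleGraph.pathGraph m) (SimpleGraph.pathGraph n)))
    (h : edist x y ≠ ⊤) :
    edist x y ≤ ENNReal.ofReal (max |affineExtension (fun p => (p.1 : ℝ)) x -
      affineExtension (fun p => (p.1 : ℝ)) y| r) := by
  have := edist_le_max_of_grading (f := fun p : Fin m × Fin n => (p.1 : ℤ))
    (fun a b => directProduct_pathGraph_adj_fst) (exists_directProduct_pathGraph_adj hm hn)
    (exists_edist_le_max hm hn hr) x y h
  simpa only [Int.cast_natCast] using this

theorem abs_fst_sub_fst_le_one (p q : Fin m × Fin n)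
    (h : (directProduct (SimpleGraph.pathGraph m) (SimpleGraph.pathGraph n)).Adj p q) :
    |(p.1 : ℝ) - q.1| ≤ 1 := by
  have : |(p.1 : ℤ) - q.1| ≤ 1 := by
    have := directProduct_pathGraph_adj_fst h
    rw [abs_le]
    omega
  exact_mod_cast this

theorem abs_snd_sub_snd_le_one (p q : Fin m × Fin n)
    (h : (directProduct (SimpleGraph.pathGraph m) (SimpleGraph.pathGraph n)).Adj p q) :
    |(p.2 : ℝ) - q.2| ≤ 1 := by
  have : |(p.2 : ℤ) - q.2| ≤ 1 := by
    have := directProduct_pathGraph_adj_snd h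
    rw [abs_le]
    omega
  exact_mod_cast this

theorem graphDelta_directProduct_le (hm : 2 ≤ m) (hn : 2 ≤ n) {r : ℕ}
    (hr : n ≤ r + 1 ∨ n = 2) :
    graphDelta (directProduct (SimpleGraph.pathGraph m) (SimpleGraph.pathGraph n)) ≤ r := by
  have := delta_le_of_edist_le_max (r := r) _ (abs_affineExtension_sub_le abs_fst_sub_fst_le_one)
    (fun x y h => (edist_directProduct_le_max hm hn hr x y h).trans_eq (by simp))
  simpa [graphDelta] using this

theorem graphDelta_directProduct_le_half (hn : 2 ≤ n) (hmn : n ≤ m) :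
    graphDelta (directProduct (SimpleGraph.pathGraph m) (SimpleGraph.pathGraph n)) ≤
      ENNReal.ofReal (((m : ℝ) - 1) / 2) := by
  have hm1 : ((m - 1 : ℕ) : ℝ) = m - 1 := by rw [Nat.cast_sub (by omega)]; simp
  rw [← hm1]
  refine delta_le_half_of_edist_le (by positivity) fun x y h =>
    (edist_directProduct_le_max (r := m - 1) (hn.trans hmn) hn (.inl (by omega)) x y h).trans
      (ENNReal.ofReal_le_ofReal (max_le ?_ le_rfl))
  have hF : ∀ z : MetricGraph
      (directProduct (SimpleGraph.pathGraph m) (SimpleGraph.pathGraph n)),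
      0 ≤ affineExtension (fun p => (p.1 : ℝ)) z ∧
        affineExtension (fun p => (p.1 : ℝ)) z ≤ (m - 1 : ℕ) := by
    intro z
    obtain ⟨a, b, hz⟩ := z.2
    constructor
    · rw [hz.affineExtension_eq]
      have := hz.nonneg a
      have := hz.le_one a
      have : 0 ≤ 1 - z.1 a := by linarith
      positivity
    · exact affineExtension_le hz (Nat.cast_le.2 (by omega)) (Nat.cast_le.2 (by omega))
  have hx := hF x
  have hy := hF y
  rw [abs_le]
  constructor <;> linarith

end Product

/-! ### Walks as geodesics, and lower bounds from bigons. -/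

section Walk

variable {V : Type*} {G : SimpleGraph V} {v : ℕ → V}

theorem onCell_of_mem_Icc {a b : V} (h : a = b ∨ G.Adj a b) {t : ℝ} (h0 : 0 ≤ t) (h1 : t ≤ 1) :
    OnCell G a b (Finsupp.single a (1 - t) + Finsupp.single b t) := by
  refine ⟨h, 1 - t, t, by linarith, h0, by ring, ?_⟩
  simp only [Finsupp.smul_single, smul_eq_mul, mul_one]

/-- The point at time `t` of the walk with vertices `v 0, v 1, …`, which may pause at a vertex. -/
noncomputable def walkPoint (hv : ∀ i, v i = v (i + 1) ∨ G.Adj (v i) (v (i + 1)))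
    (t : ℝ) : MetricGraph G :=
  ⟨Finsupp.single (v ⌊t⌋₊) (1 - Int.fract t) + Finsupp.single (v (⌊t⌋₊ + 1)) (Int.fract t), _, _,
    onCell_of_mem_Icc (hv _) (Int.fract_nonneg t) (Int.fract_lt_one t).le⟩

variable (hv : ∀ i, v i = v (i + 1) ∨ G.Adj (v i) (v (i + 1)))

theorem onCell_walkPoint (t : ℝ) : OnCell G (v ⌊t⌋₊) (v (⌊t⌋₊ + 1)) (walkPoint hv t).1 :=
  onCell_of_mem_Icc (hv _) (Int.fract_nonneg t) (Int.fract_lt_one t).le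

theorem walkPoint_natCast (i : ℕ) : walkPoint hv i = vertexPoint G (v i) := by
  apply Subtype.ext
  simp [walkPoint, vertexPoint]

theorem affineExtension_walkPoint (f : V → ℝ) (t : ℝ) : affineExtension f (walkPoint hv t) =
    (1 - Int.fract t) * f (v ⌊t⌋₊) + Int.fract t * f (v (⌊t⌋₊ + 1)) := by
  simp [affineExtension, walkPoint]
  ring

theorem edist_walk_le (hv : ∀ i, v i = v (i + 1) ∨ G.Adj (v i) (v (i + 1))) (i j : ℕ) : G.edist (v i) (v (i + j)) ≤ j := by
  induction j with
  | zero => simp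
  | succ j ih =>
    refine SimpleGraph.edist_triangle.trans ((add_le_add ih ?_).trans_eq (Nat.cast_succ j).symm)
    rcases hv (i + j) with h | h
    · rw [← add_assoc, ← h]
      simp
    · exact (SimpleGraph.edist_eq_one_iff_adj.2 h).le

/-- Within one step this compares coordinates on an edge; otherwise go to the next vertex, follow
the walk, and finish on the last edge. Pauses only shorten the route. -/
theorem edist_walkPoint_le {s t : ℝ} (hs : 0 ≤ s) (ht : 0 ≤ t) :
    edist (walkPoint hv s) (walkPoint hv t) ≤ ENNReal.ofReal |s - t| := by
  wlog hst : s ≤ t generalizing s t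
  · rw [edist_comm, abs_sub_comm]
    exact this ht hs (by linarith)
  have hfloor : ∀ {u : ℝ}, 0 ≤ u → Int.fract u = u - ⌊u⌋₊ := fun {u} hu => by
    rw [natCast_floor_eq_intCast_floor hu]
    rfl
  have hx := onCell_walkPoint hv s
  have hy := onCell_walkPoint hv t
  have hval : ∀ {u : ℝ}, v ⌊u⌋₊ ≠ v (⌊u⌋₊ + 1) →
      (walkPoint hv u).1 (v ⌊u⌋₊) = 1 - Int.fract u := fun h => by
    simp [walkPoint, h]
  rcases (Nat.floor_mono hst).eq_or_lt with he | hlt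
  · rw [← he] at hy
    refine (edist_le_of_onCell_of_onCell hx hy).trans (ENNReal.ofReal_le_ofReal ?_)
    by_cases hne : v ⌊s⌋₊ = v (⌊s⌋₊ + 1)
    · have h1 := hx
      have h2 := hy
      rw [← hne] at h1 h2
      rw [h1.self_eq, h2.self_eq]
      simp
    · have h2 := hval (u := t) (by rwa [← he])
      rw [← he] at h2
      rw [hval hne, h2, hfloor hs, hfloor ht, ← he, abs_sub_comm s]
      apply le_of_eq
      congr 1
      ring
  · obtain ⟨j, hj⟩ := Nat.exists_eq_add_of_lt hlt
    have hN := edist_walk_le hv (⌊s⌋₊ + 1) j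
    rw [show ⌊s⌋₊ + 1 + j = ⌊t⌋₊ by omega] at hN
    refine (edist_le_of_onCell hx.symm hy hN).trans (ENNReal.ofReal_le_ofReal ?_)
    have hjR : (⌊t⌋₊ : ℝ) = ⌊s⌋₊ + j + 1 := by exact_mod_cast hj
    have h1 : 1 - (walkPoint hv s).1 (v (⌊s⌋₊ + 1)) ≤ 1 - Int.fract s := by
      by_cases hne : v ⌊s⌋₊ = v (⌊s⌋₊ + 1)
      · have h := hx
        rw [← hne] at h ⊢
        rw [h.self_eq]
        linarith [Int.fract_lt_one s]
      · linarith [hx.sum_eq hne, hval hne]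
    have h2 : 1 - (walkPoint hv t).1 (v ⌊t⌋₊) ≤ Int.fract t := by
      by_cases hne : v ⌊t⌋₊ = v (⌊t⌋₊ + 1)
      · have h := hy
        rw [← hne] at h
        rw [h.self_eq]
        linarith [Int.fract_nonneg t]
      · linarith [hval hne]
    rw [hfloor hs] at h1
    rw [hfloor ht] at h2
    rw [abs_sub_comm, abs_of_nonneg (by linarith)]
    linarith

/-- A walk along which a `1`-Lipschitz function grows with speed `1` is a geodesic. -/
theorem isGeodesic_image_walkPoint {f : V → ℝ} (hf : ∀ a b, G.Adj a b → |f a - f b| ≤ 1) {N : ℕ}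
    (hfv : ∀ i ≤ N, f (v i) = i) :
    IsGeodesic (vertexPoint G (v 0)) (vertexPoint G (v N)) (walkPoint hv '' Set.Icc 0 N) := by
  have hF : ∀ t ∈ Set.Icc (0 : ℝ) N, affineExtension f (walkPoint hv t) = t := by
    intro t ht
    have hfl : (⌊t⌋₊ : ℝ) + Int.fract t = t := by
      rw [natCast_floor_eq_intCast_floor ht.1]
      exact Int.floor_add_fract t
    rw [affineExtension_walkPoint, hfv _ (Nat.floor_le_of_le ht.2)]
    -- At `t = N` nothing is known of `f (v (N + 1))`, but its weight is zero.
    rcases ht.2.eq_or_lt with rfl | hlt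
    · simp
    · rw [hfv _ ((Nat.floor_lt ht.1).2 hlt)]
      push_cast
      linarith
  refine ⟨0, N, walkPoint hv, Nat.cast_nonneg N, ?_, walkPoint_natCast hv N, rfl,
    fun s hs t ht => le_antisymm (edist_walkPoint_le hv hs.1 ht.1) ?_⟩
  · simpa using walkPoint_natCast hv 0
  · have := abs_affineExtension_sub_le hf (walkPoint hv s) (walkPoint hv t)
    rwa [hF s hs, hF t ht] at this

/-- Two geodesics with common ends, one of which leaves a `1`-Lipschitz function small while the
other one makes it large, bound the hyperbolicity constant from below. -/
theorem le_graphDelta_of_bigon {x y p : MetricGraph G} {S S' : Set (MetricGraph G)}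
    (h : IsGeodesic x y S) (h' : IsGeodesic x y S') (hp : p ∈ S) {g : V → ℝ}
    (hg : ∀ a b, G.Adj a b → |g a - g b| ≤ 1) {C : ℝ} {k : ℕ}
    (hS' : ∀ q ∈ S', affineExtension g q ≤ C) (hgp : affineExtension g p = C + k) :
    (k : ℝ≥0∞) ≤ graphDelta G := by
  have hrev : IsGeodesic y x S' := by
    obtain ⟨a, b, γ, hab, hx, hy, rfl, hγ⟩ := h'
    refine ⟨-b, -a, fun t => γ (-t), by linarith, by simpa using hy, by simpa using hx, ?_, ?_⟩
    · change _ = (γ ∘ Neg.neg) '' _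
      rw [Set.image_comp, Set.image_neg_Icc, neg_neg, neg_neg]
    · intro s hs t ht
      rw [hγ (-s) ⟨by linarith [hs.2], by linarith [hs.1]⟩ (-t)
        ⟨by linarith [ht.2], by linarith [ht.1]⟩, neg_sub_neg, abs_sub_comm]
  have hpt : IsGeodesic y y {y} := by
    refine ⟨0, 0, fun _ => y, le_rfl, rfl, rfl, by simp, ?_⟩
    intro s hs t ht
    rw [Set.Icc_self, Set.mem_singleton_iff] at hs ht
    simp [hs, ht]
  -- The bigon is a triangle with a repeated vertex and a constant side.
  let T : GeodesicTriangle (MetricGraph G) := ⟨x, y, y, S, {y}, S', h, hpt, hrev⟩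
  refine le_trans ?_ (le_iSup GeodesicTriangle.delta T)
  refine le_iInf₂ fun r hr => le_trans ?_ (hr.1 p hp)
  refine Metric.le_infEDist.2 fun q hq => ?_
  have hqS' : q ∈ S' := by
    rcases hq with hq | hq
    · rw [show q = y from hq]
      exact h'.right_mem
    · exact hq
  refine le_trans ?_ (abs_affineExtension_sub_le hg p q)
  rw [← ENNReal.ofReal_natCast]
  apply ENNReal.ofReal_le_ofReal
  have := hS' q hqS'
  rw [hgp]
  exact le_trans (by linarith) (le_abs_self _)

end Walk

/-! ### The bigon in the product, and the theorem. -/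

theorem le_graphDelta_directProduct {m n k : ℕ} (hm : 2 * k + 1 ≤ m) (hn : k + 2 ≤ n) :
    (k : ℝ≥0∞) ≤
      graphDelta (directProduct (SimpleGraph.pathGraph m) (SimpleGraph.pathGraph n)) := by
  -- `v` traces a tent of height `k` over row `1`, and `w` alternates between rows `1` and `0`.
  -- Truncation makes both pause after time `2 * k`, where they meet again.
  let v : ℕ → Fin m × Fin n := fun i =>
    (⟨min i (2 * k), by omega⟩, ⟨1 + min i (2 * k - i), by omega⟩)
  let w : ℕ → Fin m × Fin n := fun i =>
    (⟨min i (2 * k), by omega⟩, ⟨1 - min i (2 * k) % 2, by omega⟩)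
  have hv : ∀ i, v i = v (i + 1) ∨
      (directProduct (SimpleGraph.pathGraph m) (SimpleGraph.pathGraph n)).Adj (v i) (v (i + 1)) := by
    intro i
    simp only [v, directProduct, SimpleGraph.pathGraph_adj, Prod.mk.injEq, Fin.mk.injEq]
    omega
  have hw : ∀ i, w i = w (i + 1) ∨
      (directProduct (SimpleGraph.pathGraph m) (SimpleGraph.pathGraph n)).Adj (w i) (w (i + 1)) := by
    intro i
    simp only [w, directProduct, SimpleGraph.pathGraph_adj, Prod.mk.injEq, Fin.mk.injEq]
    omega
  have gv := isGeodesic_image_walkPoint hv (N := 2 * k) abs_fst_sub_fst_le_one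
    fun i hi => Nat.cast_inj.2 (min_eq_left hi)
  have gw := isGeodesic_image_walkPoint hw (N := 2 * k) abs_fst_sub_fst_le_one
    fun i hi => Nat.cast_inj.2 (min_eq_left hi)
  have h0 : w 0 = v 0 := Prod.ext rfl (Fin.ext (by
    change 1 - min 0 (2 * k) % 2 = 1 + min 0 (2 * k - 0)
    omega))
  have h1 : w (2 * k) = v (2 * k) := Prod.ext rfl (Fin.ext (by
    change 1 - min (2 * k) (2 * k) % 2 = 1 + min (2 * k) (2 * k - 2 * k)
    omega))
  rw [h0, h1] at gw
  refine le_graphDelta_of_bigon gv gw (p := vertexPoint _ (v k))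
    ⟨k, ⟨Nat.cast_nonneg k, Nat.cast_le.2 (by omega)⟩, walkPoint_natCast hv k⟩
    abs_snd_sub_snd_le_one (C := 1) ?_ ?_
  · rintro _ ⟨t, -, rfl⟩
    have hle : ∀ i, ((w i).2 : ℝ) ≤ 1 := fun i => by
      exact_mod_cast (Nat.sub_le 1 (min i (2 * k) % 2))
    exact affineExtension_le (onCell_walkPoint hw t) (hle _) (hle _)
  · rw [← walkPoint_natCast hv, affineExtension_walkPoint]
    have : ((v k).2 : ℕ) = 1 + k := by
      change 1 + min k (2 * k - k) = 1 + k
      omega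
    simp [this]

end GraphHyperbolicity

theorem mainTheorem10 (m n : ℕ) (hn : 2 ≤ n) (hmn : n ≤ m) :
    (n = 2 →
      GraphHyperbolicity.graphDelta (GraphHyperbolicity.directProduct
        (SimpleGraph.pathGraph m) (SimpleGraph.pathGraph n)) = 0) ∧
    (3 ≤ n →
      ENNReal.ofReal (min ((m : ℝ) / 2) ((n : ℝ) - 1) - 1) ≤
        GraphHyperbolicity.graphDelta (GraphHyperbolicity.directProduct
          (SimpleGraph.pathGraph m) (SimpleGraph.pathGraph n)) ∧
      GraphHyperbolicity.graphDelta (GraphHyperbolicity.directProduct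
          (SimpleGraph.pathGraph m) (SimpleGraph.pathGraph n)) ≤
        ENNReal.ofReal (min ((m : ℝ) / 2) (n : ℝ) - 1 / 2)) ∧
    ((m : ℤ) ≤ 2 * (n : ℤ) - 3 → Odd m →
      GraphHyperbolicity.graphDelta (GraphHyperbolicity.directProduct
        (SimpleGraph.pathGraph m) (SimpleGraph.pathGraph n)) =
        ENNReal.ofReal (((m : ℝ) - 1) / 2)) := by
  have hhalf := GraphHyperbolicity.graphDelta_directProduct_le_half hn hmn
  refine ⟨fun h2 => ?_, fun h3 => ⟨?_, ?_⟩, fun hle hodd => le_antisymm hhalf ?_⟩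
  · have := GraphHyperbolicity.graphDelta_directProduct_le (r := 0) (hn.trans hmn) hn (.inr h2)
    simpa using this
  -- The largest `k` that fits; rounding down in `(m - 1) / 2` still leaves at least `m / 2 - 1`.
  · have hk := GraphHyperbolicity.le_graphDelta_directProduct (m := m) (n := n)
      (k := min ((m - 1) / 2) (n - 2)) (by omega) (by omega)
    refine le_trans ?_ hk
    rw [← ENNReal.ofReal_natCast]
    apply ENNReal.ofReal_le_ofReal
    rw [Nat.cast_min]
    refine le_min ?_ ?_
    · have : (m : ℝ) ≤ (2 * ((m - 1) / 2) + 2 : ℕ) := Nat.cast_le.2 (by omega)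
      push_cast at this
      linarith [min_le_left ((m : ℝ) / 2) ((n : ℝ) - 1)]
    · rw [Nat.cast_sub hn]
      push_cast
      linarith [min_le_right ((m : ℝ) / 2) ((n : ℝ) - 1)]
  · rcases le_total ((m : ℝ) / 2) n with h | h
    · rw [min_eq_left h]
      exact hhalf.trans (ENNReal.ofReal_le_ofReal (by linarith))
    · rw [min_eq_right h]
      refine (GraphHyperbolicity.graphDelta_directProduct_le (r := n - 1) (hn.trans hmn) hn
        (.inl (by omega))).trans ?_
      rw [← ENNReal.ofReal_natCast, Nat.cast_sub (by omega)]
      exact ENNReal.ofReal_le_ofReal (by push_cast; linarith)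
  · obtain ⟨k, rfl⟩ := hodd
    refine le_trans (le_of_eq ?_)
      (GraphHyperbolicity.le_graphDelta_directProduct (k := k) le_rfl (by omega))
    rw [← ENNReal.ofReal_natCast]
    congr 1
    push_cast
    ring
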